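/- Let $M$ be a smooth $n$-dimensional manifold and $D\subset TM$ an open set of nonzero tangent vectors that is closed under multiplication by positive scalars. A function $L=L(x,y)$ makes $(M,L)$ a Finsler space on $D$ if on $D$ it is smooth, positive, positively homogeneous of degree one in $y$, and its fundamental tensor $g_{ij}=\frac12\dot\partial_i\dot\partial_jL^2$ is nondegenerate; here $\partial_i=\partial/\partial x^i$ and $\dot\partial_i=\partial/\partial y^i$ in local coordinates $(x^i,y^i)$ of $TM$ induced by coordinates $(x^i)$ of $M$. For such an $L$ put $$G^i=\tfrac14 g^{ir}\big(y^k\partial_k\dot\partial_rL^2-\partial_rL^2\big),\quad G^i_k=\dot\partial_kG^i,\quad G^i_{kh}=\dot\partial_hG^i_k,\quad \delta_j=\partial_j-G^r_j\dot\partial_r,$$ $$F^i_{jk}=\tfrac12g^{ir}(\delta_jg_{rk}+\delta_kg_{rj}-\delta_rg_{jk}),\quad C^i_{jk}=\tfrac12g^{ir}\dot\partial_kg_{rj},\quad h_{ij}=g_{ij}-\dot\partial_iL\,\dot\partial_jL .$$ The $G^i_{kh}$ are the Berwald connection coefficients, and $(F^i_{jk},G^i_j,C^i_{jk})$ is the Cartan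 connection. For a smooth covector field $b_i(x,y)$ on $D$ put $b_{i|j}=\delta_jb_i-b_rF^r_{ij}$ and $b_i|_j=\dot\partial_jb_i-b_rC^r_{ij}$. It is an $h$-vector of $(M,L)$ if $b_i|_k=0$ and $L\,C^h_{ij}b_h=\rho\,h_{ij}$ for some nowhere vanishing scalar function $\rho$ on $D$; it is parallel with respect to the Cartan connection of $(M,L)$ if $b_{i|j}=0$. Theorem 3.2. Let $F^n=(M,L)$ be a Finsler space on $D$, let $b_i(x,y)$ be an $h$-vector of $F^n$, and suppose that the Kropina change $${}^*L(x,y)=\frac{L^2(x,y)}{b_i(x,y)\,y^i}$$ defines a Finsler space ${}^*F^n=(M,{}^*L)$ on $D$. If $b_i$ is parallel with respect to the Cartan connection of $F^n$, then the Berwald connection coefficients of $F^n$ and ${}^*F^n$ coincide: ${}^*G^i_{kh}=G^i_{kh}$ on $D$ in every coordinate system. -/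

import Mathlib

open scoped Manifold ContDiff

noncomputable section

namespace Finsler

/-! ### Finsler geometry in one coordinate system

A point of `Coord n × Coord n` is a pair `(x, y)`: a position `x` and a direction `y`. -/

/-- Coordinate space of dimension `n`. -/
abbrev Coord (n : ℕ) : Type := EuclideanSpace ℝ (Fin n)

/-- `∂_i f`, the partial derivative with respect to the position coordinate `x^i`. -/
def dx {n : ℕ} (i : Fin n) (f : Coord n × Coord n → ℝ) (p : Coord n × Coord n) : ℝ :=
  fderiv ℝ f p (EuclideanSpace.single i 1, 0)

/-- The partial derivative of `f` with respect to the directional coordinate `y^i`. -/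
def dy {n : ℕ} (i : Fin n) (f : Coord n × Coord n → ℝ) (p : Coord n × Coord n) : ℝ :=
  fderiv ℝ f p (0, EuclideanSpace.single i 1)

/-- The fundamental tensor `g_ij = (1/2) ∂² L² / ∂y^i ∂y^j`. -/
def metric {n : ℕ} (L : Coord n × Coord n → ℝ) (p : Coord n × Coord n) :
    Matrix (Fin n) (Fin n) ℝ :=
  Matrix.of fun i j => (1 / 2) * dy j (dy i fun q => L q ^ 2) p

/-- The inverse `g^ij` of the fundamental tensor. -/
def metricInv {n : ℕ} (L : Coord n × Coord n → ℝ) (p : Coord n × Coord n) :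
    Matrix (Fin n) (Fin n) ℝ :=
  (metric L p)⁻¹

/-- The angular metric tensor `h_ij = g_ij - l_i l_j`, where `l_i = ∂L/∂y^i`. -/
def angularMetric {n : ℕ} (L : Coord n × Coord n → ℝ) (i j : Fin n) (p : Coord n × Coord n) : ℝ :=
  metric L p i j - dy i L p * dy j L p

/-- The spray coefficients
`G^i = (1/4) g^ir (y^k ∂² L² / ∂x^k ∂y^r - ∂ L² / ∂x^r)`. -/
def spray {n : ℕ} (L : Coord n × Coord n → ℝ) (i : Fin n) (p : Coord n × Coord n) : ℝ :=
  (1 / 4) * ∑ r, metricInv L p i r *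
    ((∑ k, p.2 k * dx k (dy r fun q => L q ^ 2) p) - dx r (fun q => L q ^ 2) p)

/-- The nonlinear connection `N^i_j = G^i_j = ∂G^i / ∂y^j`. -/
def nonlinConn {n : ℕ} (L : Coord n × Coord n → ℝ) (i j : Fin n) (p : Coord n × Coord n) : ℝ :=
  dy j (spray L i) p

/-- The Berwald connection coefficients `G^i_kh = ∂G^i_k / ∂y^h`. -/
def berwald {n : ℕ} (L : Coord n × Coord n → ℝ) (i k h : Fin n) (p : Coord n × Coord n) : ℝ :=
  dy h (nonlinConn L i k) p

/-- The horizontal derivation `δ_j = ∂/∂x^j - N^r_j ∂/∂y^r`. -/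
def hDeriv {n : ℕ} (L : Coord n × Coord n → ℝ) (j : Fin n) (f : Coord n × Coord n → ℝ)
    (p : Coord n × Coord n) : ℝ :=
  dx j f p - ∑ r, nonlinConn L r j p * dy r f p

/-- The horizontal coefficients of the Cartan connection,
`F^i_jk = (1/2) g^ir (δ_j g_rk + δ_k g_rj - δ_r g_jk)`. -/
def cartanF {n : ℕ} (L : Coord n × Coord n → ℝ) (i j k : Fin n) (p : Coord n × Coord n) : ℝ :=
  (1 / 2) * ∑ r, metricInv L p i r *
    (hDeriv L j (fun q => metric L q r k) p + hDeriv L k (fun q => metric L q r j) p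
      - hDeriv L r (fun q => metric L q j k) p)

/-- The vertical coefficients of the Cartan connection (the Cartan tensor with one index raised),
`C^i_jk = g^ir C_rjk` with `C_rjk = (1/2) ∂g_rj / ∂y^k`. -/
def cartanC {n : ℕ} (L : Coord n × Coord n → ℝ) (i j k : Fin n) (p : Coord n × Coord n) : ℝ :=
  ∑ r, metricInv L p i r * ((1 / 2) * dy k (fun q => metric L q r j) p)

/-- The h-covariant derivative `b_{i|j} = δ_j b_i - b_r F^r_ij` with respect to the Cartan
connection of `L`. -/
def hCov {n : ℕ} (L : Coord n × Coord n → ℝ) (b : Fin n → Coord n × Coord n → ℝ) (i j : Fin n)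
    (p : Coord n × Coord n) : ℝ :=
  hDeriv L j (b i) p - ∑ r, b r p * cartanF L r i j p

/-- The v-covariant derivative `b_i|_j = ∂b_i/∂y^j - b_r C^r_ij` with respect to the Cartan
connection of `L`. -/
def vCov {n : ℕ} (L : Coord n × Coord n → ℝ) (b : Fin n → Coord n × Coord n → ℝ) (i j : Fin n)
    (p : Coord n × Coord n) : ℝ :=
  dy j (b i) p - ∑ r, b r p * cartanC L r i j p

/-! ### Finsler geometry on a manifold, read in coordinate systems -/

section Manifold

variable {n : ℕ} {M : Type*} [TopologicalSpace M] [ChartedSpace (Coord n) M]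

/-- The tangent vector `y^i ∂/∂x^i` at the point with coordinates `x`, in the chart `φ`
(meaningful for `x ∈ φ.target`). -/
def tangentOf (φ : OpenPartialHomeomorph M (Coord n)) (p : Coord n × Coord n) :
    TangentBundle (𝓡 n) M :=
  ⟨φ.symm p.1, mfderiv (𝓡 n) (𝓡 n) φ.symm p.1 p.2⟩

/-- The coordinate domain of a set `D` of tangent vectors in the chart `φ`. -/
def localDomain (φ : OpenPartialHomeomorph M (Coord n)) (D : Set (TangentBundle (𝓡 n) M)) :
    Set (Coord n × Coord n) :=
  {p | p.1 ∈ φ.target ∧ tangentOf φ p ∈ D}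

/-- The expression `f(x, y)`, in the chart `φ`, of a function of tangent vectors. -/
def localFun (φ : OpenPartialHomeomorph M (Coord n)) (f : TangentBundle (𝓡 n) M → ℝ)
    (p : Coord n × Coord n) : ℝ :=
  f (tangentOf φ p)

/-- A direction-dependent covector field `b(x, y)`: to each tangent vector `y` at `x` it assigns a
covector at the same point `x`. -/
abbrev CovectorField (n : ℕ) (M : Type*) [TopologicalSpace M] [ChartedSpace (Coord n) M] : Type _ :=
  (u : TangentBundle (𝓡 n) M) → TangentSpace (𝓡 n) u.proj →L[ℝ] ℝ

/-- The components `b_i(x, y) = b(x, y)(∂/∂x^i)` in the chart `φ`. -/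
def localCov (φ : OpenPartialHomeomorph M (Coord n)) (b : CovectorField n M) (i : Fin n)
    (p : Coord n × Coord n) : ℝ :=
  b (tangentOf φ p) (mfderiv (𝓡 n) (𝓡 n) φ.symm p.1 (EuclideanSpace.single i (1 : ℝ)))

/-- `(M, L)` is a Finsler space, with fundamental function `L` defined on the open conic set `D` of
nonzero tangent vectors: `L` is positive, positively homogeneous of degree one in `y` and smooth,
and its fundamental tensor is nondegenerate. -/
structure IsFinslerSpace [IsManifold (𝓡 n) ∞ M] (D : Set (TangentBundle (𝓡 n) M)) (L : TangentBundle (𝓡 n) M → ℝ) :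
    Prop where
  isOpen : IsOpen D
  ne_zero : ∀ u ∈ D, u.snd ≠ 0
  conic : ∀ (x : M) (y : TangentSpace (𝓡 n) x) (t : ℝ), 0 < t →
    (⟨x, y⟩ : TangentBundle (𝓡 n) M) ∈ D → (⟨x, t • y⟩ : TangentBundle (𝓡 n) M) ∈ D
  pos : ∀ u ∈ D, 0 < L u
  homogeneous : ∀ (x : M) (y : TangentSpace (𝓡 n) x) (t : ℝ), 0 < t →
    (⟨x, y⟩ : TangentBundle (𝓡 n) M) ∈ D → L ⟨x, t • y⟩ = t * L ⟨x, y⟩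
  smooth : ∀ φ ∈ IsManifold.maximalAtlas (𝓡 n) ∞ M,
    ContDiffOn ℝ ∞ (localFun φ L) (localDomain φ D)
  nondegenerate : ∀ φ ∈ IsManifold.maximalAtlas (𝓡 n) ∞ M, ∀ p ∈ localDomain φ D,
    (metric (localFun φ L) p).det ≠ 0

/-- `b` is an h-vector of the Finsler space `(M, L)`: a smooth covector field `b_i(x, y)` with
`b_i|_k = 0` and `L C^h_ij b_h = ρ h_ij` for some nowhere vanishing scalar function `ρ`. -/
def IsHVector (D : Set (TangentBundle (𝓡 n) M)) (L : TangentBundle (𝓡 n) M → ℝ)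
    (b : CovectorField n M) : Prop :=
  (∀ φ ∈ IsManifold.maximalAtlas (𝓡 n) ∞ M, ∀ i,
    ContDiffOn ℝ ∞ (localCov φ b i) (localDomain φ D)) ∧
  (∀ φ ∈ IsManifold.maximalAtlas (𝓡 n) ∞ M, ∀ p ∈ localDomain φ D, ∀ i k,
    vCov (localFun φ L) (localCov φ b) i k p = 0) ∧
  ∃ ρ : TangentBundle (𝓡 n) M → ℝ, (∀ u ∈ D, ρ u ≠ 0) ∧
    ∀ φ ∈ IsManifold.maximalAtlas (𝓡 n) ∞ M, ∀ p ∈ localDomain φ D, ∀ i j,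
      localFun φ L p * ∑ h, cartanC (localFun φ L) h i j p * localCov φ b h p =
        localFun φ ρ p * angularMetric (localFun φ L) i j p

/-- `b` is parallel with respect to the Cartan connection of `(M, L)`: `b_{i|j} = 0`. -/
def IsParallel (D : Set (TangentBundle (𝓡 n) M)) (L : TangentBundle (𝓡 n) M → ℝ)
    (b : CovectorField n M) : Prop :=
  ∀ φ ∈ IsManifold.maximalAtlas (𝓡 n) ∞ M, ∀ p ∈ localDomain φ D, ∀ i j,
    hCov (localFun φ L) (localCov φ b) i j p = 0

/-- The function `β(x, y) = b_i(x, y) y^i`. -/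
def beta (b : CovectorField n M) (u : TangentBundle (𝓡 n) M) : ℝ :=
  b u u.snd

/-- The Kropina change `*L = L² / β` of `L` by `b`. -/
def kropina (L : TangentBundle (𝓡 n) M → ℝ) (b : CovectorField n M)
    (u : TangentBundle (𝓡 n) M) : ℝ :=
  L u ^ 2 / beta b u

end Manifold

end Finsler

end

/-! The spray of a Finsler function `K` is pinned down by one condition: if `K²` is horizontally
constant for the nonlinear connection `N` of `L`, meaning `δ_j K² = 0`, then `K` and `L` have the
same spray (`spray_eq_of_hDeriv_sq`). Indeed, contracting `∂_j K² = N^i_j ∂̇_i K²` with `y^j` gives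
`y^k ∂_k K² = 2 G^i ∂̇_i K²`; differentiating this in `y^r` and using the condition again shows that
`G^i` solves the nondegenerate linear system defining the spray of `K`.

For `K = L²/β` with `β = b_i y^i`, it therefore suffices that `δ_j` kills `L²` and `β`. The first
holds in every Finsler space (`hDeriv_sq`). The second follows from `b_{i|j} = 0` once the Cartan
connection is known to have no deflection, `y^i F^r_ij = N^r_j` (`snd_contract_cartanF`), since `δ_j
y^r = -N^r_j`. Equal sprays on an open set have equal second `y`-derivatives, which are the Berwald
coefficients. -/

namespace Finsler

/-! ### Smoothness and product rules for directional derivatives. -/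

section Calculus

variable {V : Type*} [NormedAddCommGroup V] [NormedSpace ℝ V]

theorem contDiffAt_fderiv_apply {f : V → ℝ} {p : V} (hf : ContDiffAt ℝ ∞ f p) (v : V) :
    ContDiffAt ℝ ∞ (fun q => fderiv ℝ f q v) p :=
  (hf.fderiv_right (m := ∞) (by simp)).clm_apply contDiffAt_const

theorem fderiv_fderiv_comm {f : V → ℝ} {p : V} (hf : ContDiffAt ℝ ∞ f p) (v w : V) :
    fderiv ℝ (fun q => fderiv ℝ f q v) p w = fderiv ℝ (fun q => fderiv ℝ f q w) p v := by
  have hd : DifferentiableAt ℝ (fderiv ℝ f) p :=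
    (hf.fderiv_right (m := ∞) (by simp)).differentiableAt (by simp)
  have hs : IsSymmSndFDerivAt ℝ f p :=
    hf.isSymmSndFDerivAt (by
      rw [minSmoothness_of_isRCLikeNormedField]
      exact WithTop.coe_le_coe.2 (le_top : (2 : ℕ∞) ≤ ⊤))
  rw [fderiv_clm_apply hd (differentiableAt_const v), fderiv_clm_apply hd (differentiableAt_const w)]
  simpa using hs.eq w v

theorem fderiv_mul_apply {f g : V → ℝ} {p : V} (hf : ContDiffAt ℝ ∞ f p)
    (hg : ContDiffAt ℝ ∞ g p) (v : V) :
    fderiv ℝ (fun q => f q * g q) p v = fderiv ℝ f p v * g p + f p * fderiv ℝ g p v := by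
  rw [fderiv_fun_mul (hf.differentiableAt (by simp)) (hg.differentiableAt (by simp))]
  simp
  ring

theorem fderiv_sum_mul_apply {ι : Type*} [Fintype ι] {f g : ι → V → ℝ} {p : V}
    (hf : ∀ i, ContDiffAt ℝ ∞ (f i) p) (hg : ∀ i, ContDiffAt ℝ ∞ (g i) p) (v : V) :
    fderiv ℝ (fun q => ∑ i, f i q * g i q) p v =
      ∑ i, fderiv ℝ (f i) p v * g i p + ∑ i, f i p * fderiv ℝ (g i) p v := by
  rw [fderiv_fun_sum fun i _ => ((hf i).mul (hg i)).differentiableAt (by simp)]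
  simp only [sum_apply, fderiv_mul_apply (hf _) (hg _),
    Finset.sum_add_distrib]

theorem contDiffAt_det {ι : Type*} [Fintype ι] [DecidableEq ι] {A : V → Matrix ι ι ℝ} {p : V}
    (hA : ∀ i j, ContDiffAt ℝ ∞ (fun q => A q i j) p) : ContDiffAt ℝ ∞ (fun q => (A q).det) p := by
  simp only [Matrix.det_apply]
  exact ContDiffAt.sum fun σ _ => (contDiffAt_prod fun i _ => hA _ _).const_smul _

theorem contDiffAt_matrix_inv {ι : Type*} [Fintype ι] [DecidableEq ι] {A : V → Matrix ι ι ℝ} {p : V}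
    (hA : ∀ i j, ContDiffAt ℝ ∞ (fun q => A q i j) p) (h0 : (A p).det ≠ 0) (i j : ι) :
    ContDiffAt ℝ ∞ (fun q => (A q)⁻¹ i j) p := by
  simp only [Matrix.inv_def, Matrix.smul_apply, Ring.inverse_eq_inv', smul_eq_mul,
    Matrix.adjugate_apply]
  refine ((contDiffAt_det hA).inv h0).mul (contDiffAt_det fun k l => ?_)
  -- The adjugate entry is the determinant of `A` with row `j` replaced by a constant basis vector.
  by_cases h : k = j
  · simp only [h, Matrix.updateRow_self]
    exact contDiffAt_const
  · simpa only [ne_eq, h, not_false_eq_true, Matrix.updateRow_ne] using hA k l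

end Calculus

/-! ### Partial derivatives in position and direction. -/

variable {n : ℕ} {f : Coord n × Coord n → ℝ} {p : Coord n × Coord n}

theorem contDiffAt_dx (hf : ContDiffAt ℝ ∞ f p) (i : Fin n) : ContDiffAt ℝ ∞ (dx i f) p :=
  contDiffAt_fderiv_apply hf _

theorem contDiffAt_dy (hf : ContDiffAt ℝ ∞ f p) (i : Fin n) : ContDiffAt ℝ ∞ (dy i f) p :=
  contDiffAt_fderiv_apply hf _

theorem dy_dy_comm (hf : ContDiffAt ℝ ∞ f p) (i j : Fin n) : dy i (dy j f) p = dy j (dy i f) p :=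
  fderiv_fderiv_comm hf _ _

theorem dy_dx_comm (hf : ContDiffAt ℝ ∞ f p) (i j : Fin n) : dy i (dx j f) p = dx j (dy i f) p :=
  fderiv_fderiv_comm hf _ _

theorem contDiffAt_snd_apply (k : Fin n) :
    ContDiffAt ℝ ∞ (fun q : Coord n × Coord n => q.2 k) p := by
  fun_prop

theorem fderiv_snd_apply (k : Fin n) (v : Coord n × Coord n) :
    fderiv ℝ (fun q : Coord n × Coord n => q.2 k) p v = v.2 k := by
  have := ((EuclideanSpace.proj k : Coord n →L[ℝ] ℝ).comp
    (ContinuousLinearMap.snd ℝ (Coord n) (Coord n))).hasFDerivAt (x := p)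
  change fderiv ℝ (⇑((EuclideanSpace.proj k : Coord n →L[ℝ] ℝ).comp
    (ContinuousLinearMap.snd ℝ (Coord n) (Coord n)))) p v = v.2 k
  rw [this.fderiv]
  simp

/-- Lets identities valid throughout an open set be differentiated. -/
theorem fderiv_congr_on {g : Coord n × Coord n → ℝ} {U : Set (Coord n × Coord n)} (hU : IsOpen U)
    (h : ∀ q ∈ U, f q = g q) (hp : p ∈ U) : fderiv ℝ f p = fderiv ℝ g p :=
  Filter.EventuallyEq.fderiv_eq (Filter.eventually_of_mem (hU.mem_nhds hp) h)

theorem dx_congr_on {g : Coord n × Coord n → ℝ} {U : Set (Coord n × Coord n)} (hU : IsOpen U)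
    (h : ∀ q ∈ U, f q = g q) (hp : p ∈ U) (i : Fin n) : dx i f p = dx i g p := by
  simp only [dx, fderiv_congr_on hU h hp]

theorem dy_congr_on {g : Coord n × Coord n → ℝ} {U : Set (Coord n × Coord n)} (hU : IsOpen U)
    (h : ∀ q ∈ U, f q = g q) (hp : p ∈ U) (i : Fin n) : dy i f p = dy i g p := by
  simp only [dy, fderiv_congr_on hU h hp]

theorem dx_const_mul (c : ℝ) (hf : ContDiffAt ℝ ∞ f p) (i : Fin n) :
    dx i (fun q => c * f q) p = c * dx i f p := by
  simp [dx, fderiv_const_mul (hf.differentiableAt (by simp))]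

theorem dy_const_mul (c : ℝ) (hf : ContDiffAt ℝ ∞ f p) (i : Fin n) :
    dy i (fun q => c * f q) p = c * dy i f p := by
  simp [dy, fderiv_const_mul (hf.differentiableAt (by simp))]

theorem dy_sub {g : Coord n × Coord n → ℝ} (hf : ContDiffAt ℝ ∞ f p) (hg : ContDiffAt ℝ ∞ g p)
    (i : Fin n) : dy i (fun q => f q - g q) p = dy i f p - dy i g p := by
  simp [dy, fderiv_fun_sub (hf.differentiableAt (by simp)) (hg.differentiableAt (by simp))]

theorem dy_sum_mul {f g : Fin n → Coord n × Coord n → ℝ} (hf : ∀ i, ContDiffAt ℝ ∞ (f i) p)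
    (hg : ∀ i, ContDiffAt ℝ ∞ (g i) p) (j : Fin n) :
    dy j (fun q => ∑ i, f i q * g i q) p =
      ∑ i, dy j (f i) p * g i p + ∑ i, f i p * dy j (g i) p :=
  fderiv_sum_mul_apply hf hg _

theorem dx_sum_snd_mul {g : Fin n → Coord n × Coord n → ℝ} (hg : ∀ i, ContDiffAt ℝ ∞ (g i) p)
    (j : Fin n) : dx j (fun q => ∑ i, q.2 i * g i q) p = ∑ i, p.2 i * dx j (g i) p := by
  simp only [dx]
  rw [fderiv_sum_mul_apply (fun i => contDiffAt_snd_apply i) hg]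
  simp [fderiv_snd_apply]

theorem dy_sum_snd_mul {g : Fin n → Coord n × Coord n → ℝ} (hg : ∀ i, ContDiffAt ℝ ∞ (g i) p)
    (j : Fin n) : dy j (fun q => ∑ i, q.2 i * g i q) p = g j p + ∑ i, p.2 i * dy j (g i) p := by
  simp only [dy]
  rw [fderiv_sum_mul_apply (fun i => contDiffAt_snd_apply i) hg]
  simp [fderiv_snd_apply, eq_comm]

/-- The horizontal derivation is differentiation along the horizontal lift of `∂/∂x^j`. -/
theorem hDeriv_eq_fderiv (L f : Coord n × Coord n → ℝ) (j : Fin n) (p : Coord n × Coord n) :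
    hDeriv L j f p = fderiv ℝ f p (EuclideanSpace.single j 1,
      -∑ r, nonlinConn L r j p • EuclideanSpace.single r (1 : ℝ)) := by
  have : ((EuclideanSpace.single j 1,
      -∑ r, nonlinConn L r j p • EuclideanSpace.single r (1 : ℝ)) : Coord n × Coord n) =
      (EuclideanSpace.single j 1, 0) -
        ∑ r, nonlinConn L r j p • ((0, EuclideanSpace.single r 1) : Coord n × Coord n) := by
    ext i <;> simp [Prod.fst_sum, Prod.snd_sum]
  rw [this, map_sub, map_sum]
  simp only [map_smul, smul_eq_mul, hDeriv, dx, dy]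

end Finsler

/-! ### Sprays and horizontal derivatives in one coordinate system. -/

namespace Finsler

/-- `L` is a Finsler fundamental function on the open set `U` of one coordinate system, homogeneity
being expressed by Euler's relation `y^k ∂L/∂y^k = L`. -/
structure IsFinslerOn {n : ℕ} (U : Set (Coord n × Coord n)) (L : Coord n × Coord n → ℝ) :
    Prop where
  isOpen : IsOpen U
  smooth : ∀ p ∈ U, ContDiffAt ℝ ∞ L p
  euler : ∀ p ∈ U, ∑ k, p.2 k * dy k L p = L p
  nondegenerate : ∀ p ∈ U, (metric L p).det ≠ 0

/-- The covector `4 g_ri G^i = y^k ∂² L² / ∂x^k ∂y^r - ∂ L² / ∂x^r`. -/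
noncomputable def sprayForm {n : ℕ} (L : Coord n × Coord n → ℝ) (r : Fin n) (p : Coord n × Coord n) : ℝ :=
  (∑ k, p.2 k * dx k (dy r fun q => L q ^ 2) p) - dx r (fun q => L q ^ 2) p

namespace IsFinslerOn

variable {n : ℕ} {U : Set (Coord n × Coord n)} {L : Coord n × Coord n → ℝ}
  {p : Coord n × Coord n}

theorem contDiffAt_sq (h : IsFinslerOn U L) (hp : p ∈ U) :
    ContDiffAt ℝ ∞ (fun q => L q ^ 2) p :=
  (h.smooth p hp).pow 2

theorem contDiffAt_metric (h : IsFinslerOn U L) (hp : p ∈ U) (i j : Fin n) :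
    ContDiffAt ℝ ∞ (fun q => metric L q i j) p :=
  contDiffAt_const.mul (contDiffAt_dy (contDiffAt_dy (h.contDiffAt_sq hp) i) j)

theorem contDiffAt_sprayForm (h : IsFinslerOn U L) (hp : p ∈ U) (r : Fin n) :
    ContDiffAt ℝ ∞ (sprayForm L r) p :=
  (ContDiffAt.sum fun k _ => (contDiffAt_snd_apply k).mul
    (contDiffAt_dx (contDiffAt_dy (h.contDiffAt_sq hp) r) k)).sub
    (contDiffAt_dx (h.contDiffAt_sq hp) r)

theorem contDiffAt_spray (h : IsFinslerOn U L) (hp : p ∈ U) (i : Fin n) :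
    ContDiffAt ℝ ∞ (spray L i) p :=
  contDiffAt_const.mul (ContDiffAt.sum fun r _ =>
    (contDiffAt_matrix_inv (h.contDiffAt_metric hp) (h.nondegenerate p hp) i r).mul
      (h.contDiffAt_sprayForm hp r))

theorem contDiffAt_nonlinConn (h : IsFinslerOn U L) (hp : p ∈ U) (i j : Fin n) :
    ContDiffAt ℝ ∞ (nonlinConn L i j) p :=
  contDiffAt_dy (h.contDiffAt_spray hp i) j

theorem dy_dy_sq (i j : Fin n) (p : Coord n × Coord n) :
    dy j (dy i fun q => L q ^ 2) p = 2 * metric L p i j := by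
  simp [metric]

theorem metric_symm (h : IsFinslerOn U L) (hp : p ∈ U) (i j : Fin n) :
    metric L p i j = metric L p j i := by
  simp only [metric, Matrix.of_apply, dy_dy_comm (h.contDiffAt_sq hp) i j]

/-- With `metric_symm`, this is the total symmetry of the Cartan tensor, a third derivative of `L²`.
-/
theorem dy_metric_comm (h : IsFinslerOn U L) (hp : p ∈ U) (i j k : Fin n) :
    dy k (fun q => metric L q i j) p = dy j (fun q => metric L q i k) p := by
  simp only [metric, Matrix.of_apply]
  have hd := contDiffAt_dy (h.contDiffAt_sq hp) i
  rw [dy_const_mul _ (contDiffAt_dy hd j), dy_const_mul _ (contDiffAt_dy hd k),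
    dy_dy_comm hd k j]

/-- The fundamental tensor can be cancelled. -/
theorem eq_of_metric_contract_eq (h : IsFinslerOn U L) (hp : p ∈ U) {v w : Fin n → ℝ}
    (hvw : ∀ r, ∑ i, metric L p r i * v i = ∑ i, metric L p r i * w i) : v = w :=
  Matrix.mulVec_injective_of_isUnit
    ((Matrix.isUnit_iff_isUnit_det _).2 (h.nondegenerate p hp).isUnit) (funext hvw)

theorem metricInv_contract (h : IsFinslerOn U L) (hp : p ∈ U) (v : Fin n → ℝ) (r : Fin n) :
    ∑ s, metricInv L p r s * ∑ i, metric L p s i * v i = v r := by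
  have := Matrix.mulVec_mulVec v (metricInv L p) (metric L p)
  rw [metricInv, Matrix.nonsing_inv_mul _ (h.nondegenerate p hp).isUnit, Matrix.one_mulVec] at this
  exact congrFun this r

theorem metric_contract_spray (h : IsFinslerOn U L) (hp : p ∈ U) (r : Fin n) :
    4 * ∑ i, metric L p r i * spray L i p = sprayForm L r p := by
  have := Matrix.mulVec_mulVec (fun s => sprayForm L s p) (metric L p) (metricInv L p)
  rw [metricInv, Matrix.mul_nonsing_inv _ (h.nondegenerate p hp).isUnit, Matrix.one_mulVec] at this
  rw [← congrFun this r]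
  simp only [Matrix.mulVec, dotProduct, spray, Finset.mul_sum, sprayForm, metricInv]
  refine Finset.sum_congr rfl fun i _ => Finset.sum_congr rfl fun k _ => ?_
  ring

/-! ### Homogeneity of the energy, the metric and the spray. -/

theorem euler_sq (h : IsFinslerOn U L) (hp : p ∈ U) :
    ∑ k, p.2 k * dy k (fun q => L q ^ 2) p = 2 * L p ^ 2 := by
  have hk : ∀ k, dy k (fun q => L q ^ 2) p = 2 * L p * dy k L p := fun k => by
    simp only [pow_two, dy, fderiv_mul_apply (h.smooth p hp) (h.smooth p hp)]
    ring
  calc _ = 2 * L p * ∑ k, p.2 k * dy k L p := by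
        rw [Finset.mul_sum]
        exact Finset.sum_congr rfl fun k _ => by rw [hk]; ring
    _ = _ := by rw [h.euler p hp]; ring

theorem euler_dy_sq (h : IsFinslerOn U L) (hp : p ∈ U) (r : Fin n) :
    ∑ k, p.2 k * dy k (dy r fun q => L q ^ 2) p = dy r (fun q => L q ^ 2) p := by
  have hs := h.contDiffAt_sq hp
  have := dy_congr_on h.isOpen (fun q hq => h.euler_sq hq) hp r
  rw [dy_sum_snd_mul (fun i => contDiffAt_dy hs i), dy_const_mul _ hs] at this
  simp only [dy_dy_comm hs r] at this
  linarith

theorem euler_dx_sq (h : IsFinslerOn U L) (hp : p ∈ U) (r : Fin n) :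
    ∑ k, p.2 k * dx r (dy k fun q => L q ^ 2) p = 2 * dx r (fun q => L q ^ 2) p := by
  have hs := h.contDiffAt_sq hp
  have := dx_congr_on h.isOpen (fun q hq => h.euler_sq hq) hp r
  rwa [dx_sum_snd_mul (fun i => contDiffAt_dy hs i), dx_const_mul _ hs] at this

theorem metric_contract_snd (h : IsFinslerOn U L) (hp : p ∈ U) (r : Fin n) :
    ∑ k, p.2 k * metric L p r k = 1 / 2 * dy r (fun q => L q ^ 2) p := by
  rw [← h.euler_dy_sq hp r, Finset.mul_sum]
  exact Finset.sum_congr rfl fun k _ => by rw [dy_dy_sq]; ring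

theorem euler_metric (h : IsFinslerOn U L) (hp : p ∈ U) (r i : Fin n) :
    ∑ k, p.2 k * dy k (fun q => metric L q r i) p = 0 := by
  have hr := contDiffAt_dy (h.contDiffAt_sq hp) r
  have := dy_congr_on h.isOpen (fun q hq => h.metric_contract_snd hq r) hp i
  rw [dy_sum_snd_mul (fun j => h.contDiffAt_metric hp r j), dy_const_mul _ hr, dy_dy_sq] at this
  simp only [h.dy_metric_comm hp r _ i] at this
  linarith

theorem dy_sprayForm (h : IsFinslerOn U L) (hp : p ∈ U) (r s : Fin n) :
    dy s (sprayForm L r) p = dx s (dy r fun q => L q ^ 2) p - dx r (dy s fun q => L q ^ 2) p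
      + ∑ k, p.2 k * dx k (dy s (dy r fun q => L q ^ 2)) p := by
  have hs := h.contDiffAt_sq hp
  have hr := contDiffAt_dy hs r
  unfold sprayForm
  rw [dy_sub (ContDiffAt.sum fun k _ => (contDiffAt_snd_apply k).mul (contDiffAt_dx hr k))
    (contDiffAt_dx hs r), dy_sum_snd_mul (fun k => contDiffAt_dx hr k), dy_dx_comm hs]
  simp only [dy_dx_comm hr]
  ring

theorem euler_sprayForm (h : IsFinslerOn U L) (hp : p ∈ U) (r : Fin n) :
    ∑ s, p.2 s * dy s (sprayForm L r) p = 2 * sprayForm L r p := by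
  have hr := contDiffAt_dy (h.contDiffAt_sq hp) r
  have h3 : ∑ s, p.2 s * ∑ k, p.2 k * dx k (dy s (dy r fun q => L q ^ 2)) p =
      ∑ k, p.2 k * dx k (dy r fun q => L q ^ 2) p := by
    simp only [Finset.mul_sum]
    rw [Finset.sum_comm]
    refine Finset.sum_congr rfl fun k _ => ?_
    rw [← dx_congr_on h.isOpen (fun q hq => h.euler_dy_sq hq r) hp k,
      dx_sum_snd_mul (fun i => contDiffAt_dy hr i), Finset.mul_sum]
    exact Finset.sum_congr rfl fun s _ => by ring
  simp only [h.dy_sprayForm hp, mul_add, mul_sub, Finset.sum_add_distrib, Finset.sum_sub_distrib]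
  rw [h3, h.euler_dx_sq hp]
  unfold sprayForm
  ring

theorem dy_metric_contract_spray (h : IsFinslerOn U L) (hp : p ∈ U) (r s : Fin n) :
    4 * (∑ i, dy s (fun q => metric L q r i) p * spray L i p
      + ∑ i, metric L p r i * nonlinConn L i s p) = dy s (sprayForm L r) p := by
  rw [← dy_congr_on h.isOpen (fun q hq => h.metric_contract_spray hq r) hp s,
    dy_const_mul _ (ContDiffAt.sum fun i _ =>
      (h.contDiffAt_metric hp r i).mul (h.contDiffAt_spray hp i)),
    dy_sum_mul (fun i => h.contDiffAt_metric hp r i) (fun i => h.contDiffAt_spray hp i)]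
  rfl

/-- The spray coefficients are homogeneous of degree two. -/
theorem euler_spray (h : IsFinslerOn U L) (hp : p ∈ U) (i : Fin n) :
    ∑ s, p.2 s * nonlinConn L i s p = 2 * spray L i p := by
  refine congrFun (h.eq_of_metric_contract_eq hp (v := fun i => ∑ s, p.2 s * nonlinConn L i s p)
    (w := fun i => 2 * spray L i p) fun r => ?_) i
  -- The metric is homogeneous of degree zero, so its derivative contributes nothing.
  have h0 : ∑ s, p.2 s * ∑ i, dy s (fun q => metric L q r i) p * spray L i p = 0 := by
    simp only [Finset.mul_sum, ← mul_assoc]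
    rw [Finset.sum_comm]
    simp only [← Finset.sum_mul, h.euler_metric hp, zero_mul, Finset.sum_const_zero]
  have h1 : ∑ s, p.2 s * ∑ i, metric L p r i * nonlinConn L i s p =
      ∑ i, metric L p r i * ∑ s, p.2 s * nonlinConn L i s p := by
    simp only [Finset.mul_sum]
    rw [Finset.sum_comm]
    exact Finset.sum_congr rfl fun i _ => Finset.sum_congr rfl fun s _ => by ring
  have h2 : ∑ i, metric L p r i * (2 * spray L i p) = 2 * ∑ i, metric L p r i * spray L i p := by
    rw [Finset.mul_sum]
    exact Finset.sum_congr rfl fun i _ => by ring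
  have h3 := h.euler_sprayForm hp r
  simp only [← h.dy_metric_contract_spray hp r, mul_left_comm _ (4 : ℝ), ← Finset.mul_sum,
    mul_add, Finset.sum_add_distrib] at h3
  rw [h0, h1, ← h.metric_contract_spray hp r] at h3
  rw [h2]
  linarith

/-- A geodesic spray preserves the energy: `2 G^i ∂L²/∂y^i = y^k ∂L²/∂x^k`. -/
theorem spray_contract_dy_sq (h : IsFinslerOn U L) (hp : p ∈ U) :
    2 * ∑ i, spray L i p * dy i (fun q => L q ^ 2) p =
      ∑ k, p.2 k * dx k (fun q => L q ^ 2) p := by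
  -- By Euler the double sum is twice the right side; the term `∂_r L²` removes one copy.
  have h1 : ∑ r, p.2 r * sprayForm L r p = ∑ k, p.2 k * dx k (fun q => L q ^ 2) p := by
    have : ∑ r, p.2 r * ∑ k, p.2 k * dx k (dy r fun q => L q ^ 2) p =
        2 * ∑ k, p.2 k * dx k (fun q => L q ^ 2) p := by
      simp only [Finset.mul_sum]
      rw [Finset.sum_comm]
      refine Finset.sum_congr rfl fun k _ => ?_
      rw [mul_left_comm, ← h.euler_dx_sq hp k, Finset.mul_sum]
      exact Finset.sum_congr rfl fun r _ => by ring
    simp only [sprayForm, mul_sub, Finset.sum_sub_distrib]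
    rw [this]
    ring
  rw [← h1]
  simp only [← h.metric_contract_spray hp, Finset.mul_sum]
  rw [Finset.sum_comm]
  refine Finset.sum_congr rfl fun i _ => ?_
  have h2 := h.metric_contract_snd hp i
  calc _ = 4 * spray L i p * (1 / 2 * dy i (fun q => L q ^ 2) p) := by ring
    _ = _ := by
      rw [← h2, Finset.mul_sum]
      exact Finset.sum_congr rfl fun k _ => by rw [h.metric_symm hp i k]; ring

/-- If `2 G^i ∂K²/∂y^i = y^k ∂K²/∂x^k` for smooth `G^i`, then `∂K²/∂x^r` is computed by `G^i_r` up to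
the defect of `G^i` from being the spray of `K`. -/
theorem dy_spray_contract (h : IsFinslerOn U L) {G : Fin n → Coord n × Coord n → ℝ}
    (hG : ∀ i, ∀ q ∈ U, ContDiffAt ℝ ∞ (G i) q)
    (hE : ∀ q ∈ U, 2 * ∑ i, G i q * dy i (fun q => L q ^ 2) q =
      ∑ k, q.2 k * dx k (fun q => L q ^ 2) q) (hp : p ∈ U) (r : Fin n) :
    2 * ∑ i, dy r (G i) p * dy i (fun q => L q ^ 2) p + 4 * ∑ i, metric L p r i * G i p =
      2 * dx r (fun q => L q ^ 2) p + sprayForm L r p := by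
  have hs := h.contDiffAt_sq hp
  have := dy_congr_on h.isOpen hE hp r
  rw [dy_const_mul _ (ContDiffAt.sum fun i _ => (hG i p hp).mul (contDiffAt_dy hs i)),
    dy_sum_mul (fun i => hG i p hp) (fun i => contDiffAt_dy hs i),
    dy_sum_snd_mul (fun i => contDiffAt_dx hs i)] at this
  simp only [dy_dx_comm hs, dy_dy_sq] at this
  have h2 : ∑ i, G i p * (2 * metric L p i r) = 2 * ∑ i, metric L p r i * G i p := by
    rw [Finset.mul_sum]
    exact Finset.sum_congr rfl fun i _ => by rw [h.metric_symm hp i r]; ring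
  rw [h2] at this
  unfold sprayForm
  linarith

/-- The horizontal derivatives of `L²` vanish. -/
theorem hDeriv_sq (h : IsFinslerOn U L) (hp : p ∈ U) (j : Fin n) :
    hDeriv L j (fun q => L q ^ 2) p = 0 := by
  have h1 := h.dy_spray_contract (fun i q hq => h.contDiffAt_spray hq i)
    (fun q hq => h.spray_contract_dy_sq hq) hp j
  -- For the spray of `L` itself the defect vanishes: both sides now contain `sprayForm L j p`.
  rw [h.metric_contract_spray hp] at h1
  change _ - ∑ i, dy j (spray L i) p * _ = _
  linarith

/-- A Finsler function which is horizontally constant for the nonlinear connection of `L` has the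
same spray as `L`. -/
theorem spray_eq_of_hDeriv_sq (h : IsFinslerOn U L) {K : Coord n × Coord n → ℝ}
    (hK : IsFinslerOn U K) (hd : ∀ q ∈ U, ∀ j, hDeriv L j (fun q => K q ^ 2) q = 0) (hp : p ∈ U)
    (i : Fin n) : spray K i p = spray L i p := by
  refine congrFun (hK.eq_of_metric_contract_eq hp (v := fun i => spray K i p)
    (w := fun i => spray L i p) fun r => ?_) i
  have hx : ∀ q ∈ U, ∀ j, dx j (fun q => K q ^ 2) q =
      ∑ i, nonlinConn L i j q * dy i (fun q => K q ^ 2) q := fun q hq j => by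
    have := hd q hq j
    unfold hDeriv at this
    linarith
  -- The energy relation for `K` comes from contracting `hx` with `y` and using `y^j N^i_j = 2 G^i`.
  have h1 := hK.dy_spray_contract (fun i q hq => h.contDiffAt_spray hq i) (fun q hq => by
    simp only [hx q hq, Finset.mul_sum]
    rw [Finset.sum_comm]
    refine Finset.sum_congr rfl fun i _ => ?_
    rw [← mul_assoc, ← h.euler_spray hq, Finset.sum_mul]
    exact Finset.sum_congr rfl fun k _ => by ring) hp r
  -- The `N` terms cancel, leaving both sprays contracted with the metric of `K`.
  rw [hx p hp r, ← hK.metric_contract_spray hp r] at h1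
  simp only [nonlinConn] at h1
  linarith

/-! ### Deflection of the Cartan connection and horizontal constancy. -/

theorem hDeriv_sum_mul_snd (L : Coord n × Coord n → ℝ) {f : Fin n → Coord n × Coord n → ℝ}
    (hf : ∀ i, ContDiffAt ℝ ∞ (f i) p) (j : Fin n) :
    hDeriv L j (fun q => ∑ i, f i q * q.2 i) p =
      ∑ i, p.2 i * hDeriv L j (f i) p - ∑ i, f i p * nonlinConn L i j p := by
  have h1 : ∀ i, hDeriv L j (fun q => q.2 i) p = -nonlinConn L i j p := fun i => by
    rw [hDeriv_eq_fderiv, fderiv_snd_apply]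
    simp [Pi.single_apply]
  have h2 : hDeriv L j (fun q => ∑ i, f i q * q.2 i) p =
      ∑ i, hDeriv L j (f i) p * p.2 i + ∑ i, f i p * hDeriv L j (fun q => q.2 i) p := by
    simp only [hDeriv_eq_fderiv]
    exact fderiv_sum_mul_apply hf (fun i => contDiffAt_snd_apply i) _
  simp only [h2, h1, mul_neg, Finset.sum_neg_distrib, ← sub_eq_add_neg, mul_comm (p.2 _)]

theorem hDeriv_congr_on {f g : Coord n × Coord n → ℝ} (hU : IsOpen U)
    (hfg : ∀ q ∈ U, f q = g q) (hp : p ∈ U) (j : Fin n) : hDeriv L j f p = hDeriv L j g p := by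
  simp only [hDeriv_eq_fderiv, fderiv_congr_on hU hfg hp]

/-- Differentiate `4 g_si G^i = sprayForm_s` in `y^j` and symmetrize in `s, j`: the curl part of
`dy_sprayForm` cancels. This is compatibility of the metric with the spray. -/
theorem snd_contract_hDeriv_metric (h : IsFinslerOn U L) (hp : p ∈ U) (s j : Fin n) :
    ∑ i, p.2 i * hDeriv L i (fun q => metric L q s j) p =
      ∑ i, metric L p s i * nonlinConn L i j p + ∑ i, metric L p j i * nonlinConn L i s p := by
  have hm : ∀ k, dx k (dy j (dy s fun q => L q ^ 2)) p =
      2 * dx k (fun q => metric L q s j) p := fun k => by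
    rw [← dx_const_mul _ (h.contDiffAt_metric hp s j)]
    simp only [← dy_dy_sq]
  have hm' : ∀ k, dx k (dy s (dy j fun q => L q ^ 2)) p =
      2 * dx k (fun q => metric L q s j) p := fun k => by
    rw [← hm]
    exact dx_congr_on h.isOpen (fun q hq => dy_dy_comm (h.contDiffAt_sq hq) s j) hp k
  have h1 := h.dy_metric_contract_spray hp s j
  have h2 := h.dy_metric_contract_spray hp j s
  rw [h.dy_sprayForm hp] at h1 h2
  simp only [hm, hm', mul_left_comm _ (2 : ℝ), ← Finset.mul_sum] at h1 h2
  have hsym : ∀ i, dy s (fun q => metric L q j i) p = dy i (fun q => metric L q s j) p :=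
    fun i => by
      rw [h.dy_metric_comm hp j i s]
      exact dy_congr_on h.isOpen (fun q hq => h.metric_symm hq j s) hp i
  simp only [h.dy_metric_comm hp s _ j] at h1
  simp only [hsym] at h2
  have h3 : ∑ i, p.2 i * ∑ r, nonlinConn L r i p * dy r (fun q => metric L q s j) p =
      2 * ∑ r, dy r (fun q => metric L q s j) p * spray L r p := by
    simp only [Finset.mul_sum]
    rw [Finset.sum_comm]
    refine Finset.sum_congr rfl fun r _ => ?_
    rw [mul_left_comm, ← h.euler_spray hp r, Finset.mul_sum]
    exact Finset.sum_congr rfl fun i _ => by ring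
  simp only [hDeriv, mul_sub, Finset.sum_sub_distrib]
  rw [h3]
  linarith

/-- Apply `δ_j` to `g_si y^i = ½ ∂̇_s L²`, with `δ_j y^i = -N^i_j`. -/
theorem snd_contract_hDeriv_metric' (h : IsFinslerOn U L) (hp : p ∈ U) (s j : Fin n) :
    ∑ i, p.2 i * hDeriv L j (fun q => metric L q s i) p =
      1 / 2 * hDeriv L j (dy s fun q => L q ^ 2) p + ∑ i, metric L p s i * nonlinConn L i j p := by
  have h1 := hDeriv_sum_mul_snd L (fun i => h.contDiffAt_metric hp s i) j
  have h2 : hDeriv L j (fun q => ∑ i, metric L q s i * q.2 i) p =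
      hDeriv L j (fun q => 1 / 2 * dy s (fun q => L q ^ 2) q) p :=
    hDeriv_congr_on h.isOpen (fun q hq => by
      rw [← h.metric_contract_snd hq s]
      exact Finset.sum_congr rfl fun i _ => mul_comm _ _) hp j
  have h3 : hDeriv L j (fun q => 1 / 2 * dy s (fun q => L q ^ 2) q) p =
      1 / 2 * hDeriv L j (dy s fun q => L q ^ 2) p := by
    simp only [hDeriv_eq_fderiv]
    rw [fderiv_const_mul ((contDiffAt_dy (h.contDiffAt_sq hp) s).differentiableAt (by simp))]
    simp
  linarith

/-- Differentiating `δ_j L² = 0` in `y^s` turns either side into `G^r_js ∂̇_r L²`, and the Berwald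
coefficients are symmetric. -/
theorem hDeriv_dy_sq_comm (h : IsFinslerOn U L) (hp : p ∈ U) (s j : Fin n) :
    hDeriv L j (dy s fun q => L q ^ 2) p = hDeriv L s (dy j fun q => L q ^ 2) p := by
  have key : ∀ s j, hDeriv L j (dy s fun q => L q ^ 2) p =
      ∑ r, dy s (dy j (spray L r)) p * dy r (fun q => L q ^ 2) p := fun s j => by
    have hs := h.contDiffAt_sq hp
    have := dy_congr_on h.isOpen (fun q hq => sub_eq_zero.1 (h.hDeriv_sq hq j)) hp s
    rw [dy_sum_mul (fun r => h.contDiffAt_nonlinConn hp r j) (fun r => contDiffAt_dy hs r),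
      dy_dx_comm hs] at this
    simp only [dy_dy_comm hs s] at this
    change _ = ∑ r, dy s (dy j (spray L r)) p * _ + _ at this
    unfold hDeriv
    linarith
  rw [key, key]
  exact Finset.sum_congr rfl fun r _ => by rw [dy_dy_comm (h.contDiffAt_spray hp r)]

/-- The Cartan connection is free of deflection: `y^i F^r_ij = N^r_j`. -/
theorem snd_contract_cartanF (h : IsFinslerOn U L) (hp : p ∈ U) (r j : Fin n) :
    ∑ i, p.2 i * cartanF L r i j p = nonlinConn L r j p := by
  have key : ∀ s, ∑ i, p.2 i * (hDeriv L i (fun q => metric L q s j) p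
      + hDeriv L j (fun q => metric L q s i) p - hDeriv L s (fun q => metric L q i j) p) =
      2 * ∑ i, metric L p s i * nonlinConn L i j p := fun s => by
    have h1 := h.snd_contract_hDeriv_metric hp s j
    have h2 := h.snd_contract_hDeriv_metric' hp s j
    have h3 := h.snd_contract_hDeriv_metric' hp j s
    simp only [hDeriv_congr_on (L := L) h.isOpen (fun q hq => h.metric_symm hq j _) hp] at h3
    -- Cancels the `δ ∂̇L²` terms of `h2` and `h3`; the `N` terms with free metric index `j` cancel
    -- between `h1` and `h3`.
    have h4 := h.hDeriv_dy_sq_comm hp s j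
    simp only [mul_add, mul_sub, Finset.sum_add_distrib, Finset.sum_sub_distrib]
    linarith
  rw [← h.metricInv_contract hp (fun i => nonlinConn L i j p) r]
  simp only [cartanF, Finset.mul_sum]
  rw [Finset.sum_comm]
  refine Finset.sum_congr rfl fun s _ => ?_
  rw [← Finset.mul_sum, show ∑ i, metric L p s i * nonlinConn L i j p =
    1 / 2 * (2 * ∑ i, metric L p s i * nonlinConn L i j p) by ring, ← key s, Finset.mul_sum,
    Finset.mul_sum]
  exact Finset.sum_congr rfl fun i _ => by ring

/-- If `b` is parallel, then `β = b_i y^i` is horizontally constant. -/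
theorem hDeriv_beta (h : IsFinslerOn U L) {b : Fin n → Coord n × Coord n → ℝ}
    (hb : ∀ i, ContDiffAt ℝ ∞ (b i) p) (hp : p ∈ U) (hpar : ∀ i j, hCov L b i j p = 0)
    (j : Fin n) : hDeriv L j (fun q => ∑ i, b i q * q.2 i) p = 0 := by
  rw [hDeriv_sum_mul_snd L hb, sub_eq_zero]
  have hd : ∀ i, hDeriv L j (b i) p = ∑ r, b r p * cartanF L r i j p := fun i =>
    sub_eq_zero.1 (hpar i j)
  simp only [hd, ← h.snd_contract_cartanF hp, Finset.mul_sum]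
  rw [Finset.sum_comm]
  exact Finset.sum_congr rfl fun r _ => Finset.sum_congr rfl fun i _ => by ring

theorem hDeriv_kropina_sq (h : IsFinslerOn U L) {K β : Coord n × Coord n → ℝ}
    (hK : IsFinslerOn U K) (hβ : ContDiffAt ℝ ∞ β p) (hβ0 : ∀ q ∈ U, β q ≠ 0)
    (hKL : ∀ q ∈ U, K q = L q ^ 2 / β q) (hp : p ∈ U) {j : Fin n} (hd : hDeriv L j β p = 0) :
    hDeriv L j (fun q => K q ^ 2) p = 0 := by
  have hs := h.contDiffAt_sq hp
  have h0 := h.hDeriv_sq hp j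
  rw [hDeriv_eq_fderiv] at hd h0 ⊢
  -- Clearing denominators avoids a quotient rule: applying `δ_j` leaves `β² δ_j K² = 0`.
  have hEq : ∀ q ∈ U, K q ^ 2 * (β q * β q) = L q ^ 2 * L q ^ 2 := fun q hq => by
    have := hβ0 q hq
    rw [hKL q hq]
    field_simp
  have := congrArg (fun T => T (EuclideanSpace.single j 1,
      -∑ r, nonlinConn L r j p • EuclideanSpace.single r (1 : ℝ)))
    (fderiv_congr_on h.isOpen hEq hp)
  simp only [fderiv_mul_apply (hK.contDiffAt_sq hp) (hβ.mul hβ), fderiv_mul_apply hβ hβ,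
    fderiv_mul_apply hs hs, hd, h0] at this
  simpa [hβ0 p hp] using this

end IsFinslerOn

end Finsler

/-! ### Passage from the manifold to charts. -/

namespace Finsler

variable {n : ℕ} {M : Type*} [TopologicalSpace M] [ChartedSpace (Coord n) M]
  {D : Set (TangentBundle (𝓡 n) M)} {φ : OpenPartialHomeomorph M (Coord n)}

/-- Over `φ.target`, `tangentOf φ` is the tangent map of the smooth `φ.symm`, hence continuous. -/
theorem isOpen_localDomain [IsManifold (𝓡 n) ∞ M] (hφ : φ ∈ IsManifold.maximalAtlas (𝓡 n) ∞ M)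
    (hD : IsOpen D) : IsOpen (localDomain φ D) := by
  have hc : ContinuousOn (tangentMapWithin (𝓡 n) (𝓡 n) φ.symm φ.target)
      (Bundle.TotalSpace.proj ⁻¹' φ.target) :=
    (contMDiffOn_symm_of_mem_maximalAtlas hφ).continuousOn_tangentMapWithin (by simp)
      φ.open_target.uniqueMDiffOn
  have heq : ∀ x ∈ φ.target, ∀ y : TangentSpace (𝓡 n) x,
      tangentMapWithin (𝓡 n) (𝓡 n) φ.symm φ.target ⟨x, y⟩ = tangentOf φ (x, y) := fun x hx y =>
    tangentMapWithin_eq_tangentMap (φ.open_target.uniqueMDiffOn _ hx)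
      (((contMDiffOn_symm_of_mem_maximalAtlas hφ).contMDiffAt
        (φ.open_target.mem_nhds hx)).mdifferentiableAt (by simp))
  have hc' : ContinuousOn (tangentOf φ) {p | p.1 ∈ φ.target} :=
    (hc.comp (tangentBundleModelSpaceHomeomorph (𝓡 n)).symm.continuous.continuousOn
      (t := Bundle.TotalSpace.proj ⁻¹' φ.target) (fun p hp => hp)).congr
      fun p hp => (heq p.1 hp p.2).symm
  exact hc'.isOpen_inter_preimage (φ.open_target.preimage continuous_fst) hD

theorem fderiv_snd_eq_sum (f : Coord n × Coord n → ℝ) (p : Coord n × Coord n) :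
    fderiv ℝ f p (0, p.2) = ∑ k, p.2 k * dy k f p := by
  have : ((0, p.2) : Coord n × Coord n) =
      ∑ k, p.2 k • ((0, EuclideanSpace.single k 1) : Coord n × Coord n) := by
    ext i <;> simp [Prod.fst_sum, Prod.snd_sum, Pi.single_apply]
  rw [this, map_sum]
  simp only [map_smul, smul_eq_mul, dy]

/-- Euler's relation for functions that are positively homogeneous of degree one. -/
theorem sum_snd_mul_dy_of_homogeneous {f : Coord n × Coord n → ℝ} {p : Coord n × Coord n}
    (hf : DifferentiableAt ℝ f p) (hh : ∀ t : ℝ, 0 < t → f (p.1, t • p.2) = t * f p) :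
    ∑ k, p.2 k * dy k f p = f p := by
  have hγ : HasDerivAt (fun t : ℝ => ((p.1, t • p.2) : Coord n × Coord n)) (0, p.2) 1 := by
    have := ((hasDerivAt_id (1 : ℝ)).smul_const p.2)
    rw [one_smul] at this
    exact (hasDerivAt_const (1 : ℝ) p.1).prodMk this
  have hf' : HasFDerivAt f (fderiv ℝ f p) ((p.1, (1 : ℝ) • p.2) : Coord n × Coord n) := by
    rw [one_smul]
    exact hf.hasFDerivAt
  have h1 := hf'.comp_hasDerivAt (1 : ℝ) hγ
  have h2 : HasDerivAt (fun t : ℝ => t * f p) (f p) 1 := by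
    simpa using (hasDerivAt_id (1 : ℝ)).mul_const (f p)
  have h3 := h2.congr_of_eventuallyEq (f₁ := f ∘ fun t : ℝ => (p.1, t • p.2))
    (Filter.eventually_of_mem (Ioi_mem_nhds one_pos) fun t ht => hh t ht)
  rw [← fderiv_snd_eq_sum]
  exact h1.unique h3

theorem IsFinslerSpace.isFinslerOn [IsManifold (𝓡 n) ∞ M] {L : TangentBundle (𝓡 n) M → ℝ}
    (hL : IsFinslerSpace D L) (hφ : φ ∈ IsManifold.maximalAtlas (𝓡 n) ∞ M) :
    IsFinslerOn (localDomain φ D) (localFun φ L) where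
  isOpen := isOpen_localDomain hφ hL.isOpen
  smooth p hp := (hL.smooth φ hφ).contDiffAt ((isOpen_localDomain hφ hL.isOpen).mem_nhds hp)
  euler p hp := by
    refine sum_snd_mul_dy_of_homogeneous (((hL.smooth φ hφ).contDiffAt
      ((isOpen_localDomain hφ hL.isOpen).mem_nhds hp)).differentiableAt (by simp)) fun t ht => ?_
    have := hL.homogeneous _ (mfderiv (𝓡 n) (𝓡 n) φ.symm p.1 p.2) t ht hp.2
    exact (congrArg (fun v => L ⟨φ.symm p.1, v⟩)
      ((mfderiv (𝓡 n) (𝓡 n) φ.symm p.1).map_smul t p.2)).trans this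
  nondegenerate := hL.nondegenerate φ hφ

theorem clm_apply_eq_sum (T : Coord n →L[ℝ] ℝ) (v : Coord n) :
    T v = ∑ i, T (EuclideanSpace.single i 1) * v i := by
  have : v = ∑ k, v k • EuclideanSpace.single k (1 : ℝ) := by
    ext i
    simp [Pi.single_apply]
  conv_lhs => rw [this, map_sum]
  simp only [map_smul, smul_eq_mul, mul_comm]

theorem localFun_beta (φ : OpenPartialHomeomorph M (Coord n)) (b : CovectorField n M)
    (p : Coord n × Coord n) :
    localFun φ (beta b) p = ∑ i, localCov φ b i p * p.2 i :=
  clm_apply_eq_sum ((b (tangentOf φ p)).comp (mfderiv (𝓡 n) (𝓡 n) φ.symm p.1)) p.2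

end Finsler

theorem theorem3p2 {n : ℕ} {M : Type*} [TopologicalSpace M]
    [ChartedSpace (Finsler.Coord n) M] [IsManifold (𝓡 n) ∞ M]
    (D : Set (TangentBundle (𝓡 n) M)) (L : TangentBundle (𝓡 n) M → ℝ)
    (b : Finsler.CovectorField n M)
    (hL : Finsler.IsFinslerSpace D L)
    (hb : Finsler.IsHVector D L b)
    (hK : Finsler.IsFinslerSpace D (Finsler.kropina L b))
    (hpar : Finsler.IsParallel D L b) :
    ∀ φ ∈ IsManifold.maximalAtlas (𝓡 n) ∞ M, ∀ p ∈ Finsler.localDomain φ D,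
      ∀ i k h : Fin n,
        Finsler.berwald (Finsler.localFun φ (Finsler.kropina L b)) i k h p =
          Finsler.berwald (Finsler.localFun φ L) i k h p := by
  intro φ hφ p hp i k h
  have hLU := hL.isFinslerOn hφ
  have hKU := hK.isFinslerOn hφ
  have hbs : ∀ q ∈ Finsler.localDomain φ D, ∀ i,
      ContDiffAt ℝ ∞ (Finsler.localCov φ b i) q := fun q hq i =>
    (hb.1 φ hφ i).contDiffAt (hLU.isOpen.mem_nhds hq)
  -- Where `β = 0`, division by zero would give `*L = 0`, against positivity.
  have hβ0 : ∀ q ∈ Finsler.localDomain φ D,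
      ∑ i, Finsler.localCov φ b i q * q.2 i ≠ 0 := fun q hq h0 => by
    rw [← Finsler.localFun_beta] at h0
    have hpos := hK.pos _ hq.2
    change Finsler.beta b (Finsler.tangentOf φ q) = 0 at h0
    rw [Finsler.kropina, h0, div_zero] at hpos
    exact lt_irrefl _ hpos
  have hspray : ∀ i, ∀ q ∈ Finsler.localDomain φ D,
      Finsler.spray (Finsler.localFun φ (Finsler.kropina L b)) i q =
        Finsler.spray (Finsler.localFun φ L) i q := fun i q hq =>
    hLU.spray_eq_of_hDeriv_sq hKU (fun q hq j =>
      hLU.hDeriv_kropina_sq hKU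
        (ContDiffAt.sum fun i _ => (hbs q hq i).mul (Finsler.contDiffAt_snd_apply i)) hβ0
        (fun q _ => by rw [← Finsler.localFun_beta]; rfl) hq
        (hLU.hDeriv_beta (hbs q hq) hq (hpar φ hφ q hq) j)) hq i
  exact Finsler.dy_congr_on hLU.isOpen
    (fun q hq => Finsler.dy_congr_on hLU.isOpen (hspray i) hq k) hp h
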